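/- Let $a_0, a_1, a_2 \in \mathbb R$, let $0 < \tau_1 < \tau_2$ be real numbers with $\frac{\tau_1}{\tau_2} \in (0, \frac23]$, and let $s_0 \in \mathbb R$. Consider the delay-differential equation $$y'(t) + a_0\, y(t) + a_1\, y(t - \tau_1) + a_2\, y(t - \tau_2) = 0, \qquad t \ge 0, \tag{1}$$ and its characteristic function $$\Delta(s) = s + a_0 + a_1 e^{-s \tau_1} + a_2 e^{-s \tau_2}, \qquad s \in \mathbb C.$$ If $s_0$ is a root of $\Delta$ of multiplicity $3$ (which is the maximal possible multiplicity of a root of $\Delta$), then $s_0$ is a strictly dominant root of $\Delta$, that is, every $s \in \mathbb C$ with $\Delta(s) = 0$ satisfies $s = s_0$ or $\operatorname{Re} s < s_0$. In particular, if $s_0 < 0$, then (1) is exponentially stable, that is, there exist $K > 0$ and $\alpha > 0$ such that, for every $\varphi \in C([-\tau_2, 0], \mathbb R)$ and every solution $y \colon [-\tau_2, \infty) \to \mathbb R$ of (1) with $y = \varphi$ on $[-\tau_2, 0]$, one has $|y(t)| \le K e^{-\alpha t} \max_{\theta \in [-\tau_2, 0]} |\varphi(\theta)|$ for all $t \ge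 0$. -/

import Mathlib

/-- The characteristic function `Δ(s) = s + a₀ + a₁ e^{-s τ₁} + a₂ e^{-s τ₂}` of the delay-differential
equation `y'(t) + a₀ y(t) + a₁ y(t - τ₁) + a₂ y(t - τ₂) = 0`. -/
noncomputable def charFunction (a₀ a₁ a₂ τ₁ τ₂ : ℝ) (s : ℂ) : ℂ :=
  s + a₀ + a₁ * Complex.exp (-s * τ₁) + a₂ * Complex.exp (-s * τ₂)

/-- The real number `s₀` is a strictly dominant root of `f`: it is a root, and every root of `f`
either equals `s₀` or has real part less than `s₀`. -/
def IsStrictlyDominantRoot (f : ℂ → ℂ) (s₀ : ℝ) : Prop :=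
  f s₀ = 0 ∧ ∀ s : ℂ, f s = 0 → s = s₀ ∨ s.re < s₀

/-- `y` is a solution on `[-τ₂, ∞)` of `y'(t) + a₀ y(t) + a₁ y(t - τ₁) + a₂ y(t - τ₂) = 0` for
`t ≥ 0` (one-sided derivative at `t = 0`), with initial datum `φ ∈ C([-τ₂, 0], ℝ)`. The values of
`y` on `(-∞, -τ₂)` play no role when `0 < τ₁ < τ₂`. -/
structure IsSolution (a₀ a₁ a₂ τ₁ τ₂ : ℝ) (φ : C(Set.Icc (-τ₂) 0, ℝ)) (y : ℝ → ℝ) : Prop where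
  initial : ∀ θ : Set.Icc (-τ₂) 0, y θ = φ θ
  continuousOn : ContinuousOn y (Set.Ici (-τ₂))
  equation : ∀ t : ℝ, 0 ≤ t →
    HasDerivWithinAt y (-(a₀ * y t + a₁ * y (t - τ₁) + a₂ * y (t - τ₂))) (Set.Ici 0) t

/-- Exponential stability of `y'(t) + a₀ y(t) + a₁ y(t - τ₁) + a₂ y(t - τ₂) = 0`: there are
`K, α > 0` with `|y(t)| ≤ K e^{-α t} ‖φ‖` for all `t ≥ 0`, all continuous initial data `φ` and all
solutions `y` with initial datum `φ`, where `‖φ‖` is the supremum norm. -/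
def IsExponentiallyStable (a₀ a₁ a₂ τ₁ τ₂ : ℝ) : Prop :=
  ∃ K α : ℝ, 0 < K ∧ 0 < α ∧
    ∀ (φ : C(Set.Icc (-τ₂) 0, ℝ)) (y : ℝ → ℝ), IsSolution a₀ a₁ a₂ τ₁ τ₂ φ y →
      ∀ t : ℝ, 0 ≤ t → |y t| ≤ K * Real.exp (-α * t) * ‖φ‖

/-! Put `h z = exp (-z) - 1 + z`, `w = s - s₀` and `Aᵢ = aᵢ exp (-s₀ τᵢ)`. Since `Δ` and `Δ'` vanish
at `s₀`, `Δ s = A₁ h(τ₁ w) + A₂ h(τ₂ w)`, and `Δ'' s₀ = 0` says `τ₁² A₁ = -τ₂² A₂`. So a root `s`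
satisfies `h(τ₁ w) / τ₁² = h(τ₂ w) / τ₂²`. If `Re w ≥ 0` and `w ≠ 0`, this is impossible already for
the moduli, because `|h(t w)|² / t⁴` is strictly decreasing in `t > 0`: its derivative is a negative
multiple of `remainderDefect`, a sum of nonnegative terms (`remainderRatio_ne`).

For stability, strict dominance makes `Re s ≥ σ = s₀ / 2` free of roots. A solution multiplied by a
smooth cutoff solves the equation on all of `ℝ` with a compactly supported `C¹` forcing `r`, and its
Laplace transform is `laplace r / Δ`. Both `1 / Δ` and `laplace r` decay like `1 / |s|` in vertical
strips, so the inversion integral converges absolutely and can be moved to `Re s = σ`, which gives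
`O(exp (σ t))` (`exists_forced_solution_bound`, `exists_solution_bound`). -/

/-! ### Monotonicity of `|h(t w)|² / t⁴`. -/

/-- The function `a cosh a - sinh a` controls the real part of `(2 h(z) - z h'(z)) * conj (h z)` for
`h z = exp (-z) - 1 + z` and `z = 2 a`, `a = p + q i`. -/
lemma remainder_identity (p q : ℝ) :
    (2 * p * (1 + Real.exp (-(2 * p)) * Real.cos (2 * q))
        + 2 * q * (Real.exp (-(2 * p)) * Real.sin (2 * q))
        - 2 * (1 - Real.exp (-(2 * p)) * Real.cos (2 * q)))
        * (2 * p - 1 + Real.exp (-(2 * p)) * Real.cos (2 * q))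
      + (2 * q * (1 + Real.exp (-(2 * p)) * Real.cos (2 * q))
        - 2 * p * (Real.exp (-(2 * p)) * Real.sin (2 * q))
        - 2 * (Real.exp (-(2 * p)) * Real.sin (2 * q)))
        * (2 * q - Real.exp (-(2 * p)) * Real.sin (2 * q))
      = 8 * Real.exp (-(2 * p)) *
        ((p * Real.cosh p * Real.cos q - q * Real.sinh p * Real.sin q
            - Real.sinh p * Real.cos q) ^ 2
          + (q * Real.cosh p * Real.cos q + p * Real.sinh p * Real.sin q
            - Real.cosh p * Real.sin q) ^ 2
          + p * Real.sinh p * (p * Real.cosh p - Real.sinh p)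
          + (q ^ 2 * Real.sinh p * Real.cosh p - p * Real.sin q ^ 2)) := by
  have hE : Real.exp (-(2 * p)) = Real.exp (-p) ^ 2 := by
    rw [← Real.exp_nat_mul]; congr 1; push_cast; ring
  have he : Real.exp (-p) = Real.cosh p - Real.sinh p := (Real.cosh_sub_sinh p).symm
  rw [hE, Real.cos_two_mul, Real.sin_two_mul, he]
  have h1 := Real.cosh_sq p
  have h2 := Real.sin_sq_add_cos_sq q
  set C := Real.cosh p
  set S := Real.sinh p
  set c := Real.cos q
  set s := Real.sin q
  -- For `a = p + q i`: `X + Y i = a cosh a - sinh a` and `X₂ + Y₂ i = a exp a - sinh a`. With `z =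
  -- 2 a` they give `2 h - z h' = 4 exp (-a) (X + Y i)` and `h = 2 exp (-a) (X₂ + Y₂ i)`, where `C -
  -- S = exp (-p)`.
  set X := p * C * c - q * S * s - S * c with hX
  set Y := q * C * c + p * S * s - C * s with hY
  set X₂ := (C + S) * (p * c - q * s) - S * c with hX₂
  set Y₂ := (C + S) * (p * s + q * c) - C * s with hY₂
  have e1 : 1 + (C - S) ^ 2 * (2 * c ^ 2 - 1) = 2 * (C - S) * (C * c ^ 2 + S * s ^ 2) := by
    linear_combination (-1 : ℝ) * h1 + (-2 * S * (C - S)) * h2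
  have e2 : 1 - (C - S) ^ 2 * (2 * c ^ 2 - 1) = 2 * (C - S) * (S * c ^ 2 + C * s ^ 2) := by
    linear_combination (-1 : ℝ) * h1 + (-2 * C * (C - S)) * h2
  have f1 : 2 * p * (1 + (C - S) ^ 2 * (2 * c ^ 2 - 1)) + 2 * q * ((C - S) ^ 2 * (2 * s * c))
      - 2 * (1 - (C - S) ^ 2 * (2 * c ^ 2 - 1)) = 4 * (C - S) * (c * X + s * Y) := by
    rw [e1, e2, hX, hY]; ring
  have f2 : 2 * q * (1 + (C - S) ^ 2 * (2 * c ^ 2 - 1)) - 2 * p * ((C - S) ^ 2 * (2 * s * c))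
      - 2 * ((C - S) ^ 2 * (2 * s * c)) = 4 * (C - S) * (c * Y - s * X) := by
    rw [e1, hX, hY]; ring
  have g1 : 2 * p - 1 + (C - S) ^ 2 * (2 * c ^ 2 - 1) = 2 * (C - S) * (c * X₂ + s * Y₂) := by
    have : 2 * (C - S) * (c * X₂ + s * Y₂) = 2 * p - 2 * (C - S) * (S * c ^ 2 + C * s ^ 2) := by
      rw [hX₂, hY₂]
      linear_combination (2 * p * (C ^ 2 - S ^ 2)) * h2 + 2 * p * h1
    rw [this, ← e2]; ring
  have g2 : 2 * q - (C - S) ^ 2 * (2 * s * c) = 2 * (C - S) * (c * Y₂ - s * X₂) := by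
    rw [hX₂, hY₂]
    linear_combination (-2 * q * (C ^ 2 - S ^ 2)) * h2 - 2 * q * h1
  rw [f1, f2, g1, g2]
  -- The difference of the two factors is `a sinh a`, and `Re ((a cosh a - sinh a) conj (a sinh a))
  -- = |a|² S C - p |sinh a|²` with `|sinh a|² = S² + s²`.
  have : X * X₂ + Y * Y₂ = X ^ 2 + Y ^ 2 + p * S * (p * C - S)
      + (q ^ 2 * S * C - p * s ^ 2) := by
    have hX' : X₂ = X + (p * S * c - q * C * s) := by rw [hX, hX₂]; ring
    have hY' : Y₂ = Y + (p * C * s + q * S * c) := by rw [hY, hY₂]; ring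
    have : X * (p * S * c - q * C * s) + Y * (p * C * s + q * S * c)
        = p * S * (p * C - S) + (q ^ 2 * S * C - p * s ^ 2) := by
      rw [hX, hY]
      linear_combination (p ^ 2 * S * C + q ^ 2 * S * C - p * S ^ 2) * h2 - p * s ^ 2 * h1
    rw [hX', hY']; linear_combination this
  rw [← this]
  linear_combination (8 * (C - S) ^ 2 * (X * X₂ + Y * Y₂)) * h2

lemma sinh_lt_mul_cosh {p : ℝ} (hp : 0 < p) : Real.sinh p < p * Real.cosh p := by
  have hmono : StrictMonoOn (fun x : ℝ => x * Real.cosh x - Real.sinh x) (Set.Ici 0) := by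
    apply strictMonoOn_of_deriv_pos (convex_Ici 0)
    · exact (by fun_prop : Continuous fun x : ℝ => x * Real.cosh x - Real.sinh x).continuousOn
    · intro x hx
      rw [interior_Ici] at hx
      have : HasDerivAt (fun x : ℝ => x * Real.cosh x - Real.sinh x)
          (1 * Real.cosh x + x * Real.sinh x - Real.cosh x) x :=
        ((hasDerivAt_id x).mul (Real.hasDerivAt_cosh x)).sub (Real.hasDerivAt_sinh x)
      rw [this.deriv]
      have := mul_pos hx (Real.sinh_pos_iff.2 hx)
      linarith
  have := hmono (Set.mem_Ici.2 le_rfl) (Set.mem_Ici.2 hp.le) hp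
  simp only [Real.sinh_zero, zero_mul, sub_zero] at this
  linarith

lemma sq_mul_sinh_mul_cosh_sub_nonneg {p : ℝ} (hp : 0 ≤ p) (q : ℝ) :
    0 ≤ q ^ 2 * Real.sinh p * Real.cosh p - p * Real.sin q ^ 2 := by
  have h1 : p ≤ Real.sinh p := Real.self_le_sinh_iff.2 hp
  have h2 : Real.sin q ^ 2 ≤ q ^ 2 := sq_le_sq.2 (Real.abs_sin_le_abs)
  have h3 : p ≤ Real.sinh p * Real.cosh p :=
    h1.trans (le_mul_of_one_le_right (hp.trans h1) (Real.one_le_cosh p))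
  have := mul_le_mul h2 h3 hp (sq_nonneg q)
  nlinarith

/-- `|exp (-t w) - 1 + t w|² / t ^ 4` for `w = u + v i`. -/
noncomputable def remainderRatio (u v t : ℝ) : ℝ :=
  ((Real.exp (-(t * u)) * Real.cos (t * v) - 1 + t * u) ^ 2
    + (t * v - Real.exp (-(t * u)) * Real.sin (t * v)) ^ 2) / t ^ 4

/-- Up to the factor `-16 exp (-t u) / t ^ 5`, the derivative of `remainderRatio`. -/
noncomputable def remainderDefect (p q : ℝ) : ℝ :=
  (p * Real.cosh p * Real.cos q - q * Real.sinh p * Real.sin q - Real.sinh p * Real.cos q) ^ 2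
    + (q * Real.cosh p * Real.cos q + p * Real.sinh p * Real.sin q - Real.cosh p * Real.sin q) ^ 2
    + p * Real.sinh p * (p * Real.cosh p - Real.sinh p)
    + (q ^ 2 * Real.sinh p * Real.cosh p - p * Real.sin q ^ 2)

/-- With `z = t w`, the derivative of `|h z|² / t⁴` is `-2 Re ((2 h - z h') conj h) / t⁵`, which
`remainder_identity` evaluates at `a = z / 2`. -/
lemma hasDerivAt_remainderRatio (u v : ℝ) {t : ℝ} (ht : t ≠ 0) :
    HasDerivAt (remainderRatio u v)
      (-(16 * Real.exp (-(t * u)) * remainderDefect (t * u / 2) (t * v / 2)) / t ^ 5) t := by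
  have hu : HasDerivAt (fun t : ℝ => t * u) u t := by simpa using (hasDerivAt_id t).mul_const u
  have hv : HasDerivAt (fun t : ℝ => t * v) v t := by simpa using (hasDerivAt_id t).mul_const v
  have hA := ((hu.neg.exp.mul hv.cos).sub_const 1).add hu
  have hB := hv.sub (hu.neg.exp.mul hv.sin)
  have h := ((hA.pow 2).add (hB.pow 2)).div (hasDerivAt_pow 4 t) (pow_ne_zero 4 ht)
  have key := remainder_identity (t * u / 2) (t * v / 2)
  rw [mul_div_cancel₀ _ (two_ne_zero' ℝ), mul_div_cancel₀ _ (two_ne_zero' ℝ)] at key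
  refine h.congr_deriv ?_
  rw [remainderDefect, show (16 : ℝ) * Real.exp (-(t * u)) = 2 * (8 * Real.exp (-(t * u))) by ring,
    mul_assoc 2 (8 * Real.exp (-(t * u))), ← key]
  simp only [Pi.add_apply, Pi.sub_apply, Pi.mul_apply, Pi.neg_apply, Pi.pow_apply]
  field_simp
  ring

lemma remainderDefect_nonneg {p : ℝ} (hp : 0 ≤ p) (q : ℝ) : 0 ≤ remainderDefect p q := by
  have h1 := sq_mul_sinh_mul_cosh_sub_nonneg hp q
  have h2 : 0 ≤ p * Real.sinh p * (p * Real.cosh p - Real.sinh p) := by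
    rcases hp.eq_or_lt with rfl | hp
    · simp
    · exact mul_nonneg (mul_nonneg hp.le (Real.sinh_nonneg_iff.2 hp.le))
        (sub_nonneg.2 (sinh_lt_mul_cosh hp).le)
  rw [remainderDefect]
  positivity

lemma remainderDefect_pos {p : ℝ} (hp : 0 < p) (q : ℝ) : 0 < remainderDefect p q := by
  have h1 := sq_mul_sinh_mul_cosh_sub_nonneg hp.le q
  have h2 : 0 < p * Real.sinh p * (p * Real.cosh p - Real.sinh p) :=
    mul_pos (mul_pos hp (Real.sinh_pos_iff.2 hp)) (sub_pos.2 (sinh_lt_mul_cosh hp))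
  rw [remainderDefect]
  positivity

/-- The ratio is antitone, so equal values at `t₁` and `t₂` make it constant in between and force
the defect to vanish on a whole interval. For `u > 0` the defect is positive. -/
lemma remainderRatio_ne {u v t₁ t₂ : ℝ} (hu : 0 ≤ u) (huv : u ≠ 0 ∨ v ≠ 0) (ht₁ : 0 < t₁)
    (ht : t₁ < t₂) : remainderRatio u v t₁ ≠ remainderRatio u v t₂ := by
  intro heq
  have hcont : ContinuousOn (remainderRatio u v) (Set.Icc t₁ t₂) := fun t h =>
    (hasDerivAt_remainderRatio u v (ht₁.trans_le h.1).ne').continuousAt.continuousWithinAt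
  have hanti : AntitoneOn (remainderRatio u v) (Set.Icc t₁ t₂) := by
    refine antitoneOn_of_deriv_nonpos (convex_Icc _ _) hcont ?_ ?_ <;>
      simp only [interior_Icc] <;> intro t h
    · exact (hasDerivAt_remainderRatio u v
        (ht₁.trans h.1).ne').differentiableAt.differentiableWithinAt
    · have ht0 : 0 < t := ht₁.trans h.1
      rw [(hasDerivAt_remainderRatio u v ht0.ne').deriv, neg_div]
      have := remainderDefect_nonneg (p := t * u / 2) (by positivity) (t * v / 2)
      exact neg_nonpos.2 (by positivity)
  have hconst : ∀ t ∈ Set.Icc t₁ t₂, remainderRatio u v t = remainderRatio u v t₁ := fun t h =>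
    le_antisymm (hanti (Set.left_mem_Icc.2 ht.le) h h.1)
      (heq.trans_le (hanti h (Set.right_mem_Icc.2 ht.le) h.2))
  have hzero : ∀ t ∈ Set.Ioo t₁ t₂, remainderDefect (t * u / 2) (t * v / 2) = 0 := by
    intro t h
    have ht0 : 0 < t := ht₁.trans h.1
    have hd := (hasDerivAt_remainderRatio u v ht0.ne').congr_of_eventuallyEq
      (f₁ := fun _ => remainderRatio u v t₁) (by
        filter_upwards [Icc_mem_nhds h.1 h.2] with x hx using (hconst x hx).symm)
    have := hd.unique (hasDerivAt_const t _)
    have he := Real.exp_pos (-(t * u))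
    rw [neg_div, neg_eq_zero, div_eq_zero_iff, mul_eq_zero] at this
    rcases this with (h | h) | h
    · linarith
    · exact h
    · exact absurd h (by positivity)
  rcases hu.eq_or_lt with rfl | hu
  -- On the imaginary axis the defect is only `(q cos q - sin q)²`, which does have zeros. Vanishing
  -- on an interval also kills the derivative `-q sin q`, so `sin q = cos q = 0`.
  · have hv : v ≠ 0 := by simpa using huv
    have hk : ∀ t ∈ Set.Ioo t₁ t₂, t * v / 2 * Real.cos (t * v / 2) - Real.sin (t * v / 2) = 0 := by
      intro t h
      simpa [remainderDefect] using hzero t h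
    obtain ⟨t, h⟩ := Set.nonempty_Ioo.2 ht
    have hid : HasDerivAt (fun t : ℝ => t * v / 2) (v / 2) t := by
      simpa using ((hasDerivAt_id t).mul_const v).div_const 2
    have hd := ((hid.mul hid.cos).sub hid.sin).congr_of_eventuallyEq (f₁ := fun _ => (0 : ℝ)) (by
        filter_upwards [Ioo_mem_nhds h.1 h.2] with x hx using (hk x hx).symm)
    have h0 := hd.unique (hasDerivAt_const t _)
    have hq : t * v / 2 ≠ 0 := by have := ht₁.trans h.1; positivity
    have hsin : Real.sin (t * v / 2) = 0 := by
      have : (v / 2) * (t * v / 2) * Real.sin (t * v / 2) = 0 := by linear_combination -h0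
      simpa [hv, hq, (ht₁.trans h.1).ne'] using this
    have hcos : Real.cos (t * v / 2) = 0 := by
      have := hk t h
      rw [hsin, sub_zero] at this
      exact (mul_eq_zero.1 this).resolve_left hq
    have := Real.sin_sq_add_cos_sq (t * v / 2)
    simp [hsin, hcos] at this
  · obtain ⟨t, h⟩ := Set.nonempty_Ioo.2 ht
    have : 0 < t := ht₁.trans h.1
    exact (remainderDefect_pos (by positivity) _).ne' (hzero t h)

lemma normSq_exp_neg_sub_one_add (w : ℂ) (t : ℝ) :
    Complex.normSq (Complex.exp (-(t * w)) - 1 + t * w) / t ^ 4 = remainderRatio w.re w.im t := by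
  rw [remainderRatio, Complex.normSq_apply]
  congr 1
  simp [Complex.exp_re, Complex.exp_im]
  ring

/-! ### Triple roots and strict dominance. -/

lemma charFunction_hasDerivAt (a₀ a₁ a₂ τ₁ τ₂ : ℝ) (s : ℂ) :
    HasDerivAt (charFunction a₀ a₁ a₂ τ₁ τ₂)
      (1 - τ₁ * a₁ * Complex.exp (-s * τ₁) - τ₂ * a₂ * Complex.exp (-s * τ₂)) s := by
  have h (τ : ℂ) : HasDerivAt (fun s : ℂ => Complex.exp (-s * τ))
      (Complex.exp (-s * τ) * (-1 * τ)) s := ((hasDerivAt_id s).neg.mul_const τ).cexp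
  refine ((((hasDerivAt_id s).add_const (a₀ : ℂ)).add ((h τ₁).const_mul (a₁ : ℂ))).add
    ((h τ₂).const_mul (a₂ : ℂ))).congr_deriv ?_
  ring

lemma charFunction_differentiable (a₀ a₁ a₂ τ₁ τ₂ : ℝ) :
    Differentiable ℂ (charFunction a₀ a₁ a₂ τ₁ τ₂) := fun s =>
  (charFunction_hasDerivAt a₀ a₁ a₂ τ₁ τ₂ s).differentiableAt

lemma charFunction_triple_root {a₀ a₁ a₂ τ₁ τ₂ : ℝ} {s : ℂ}
    (h : analyticOrderAt (charFunction a₀ a₁ a₂ τ₁ τ₂) s = 3) :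
    charFunction a₀ a₁ a₂ τ₁ τ₂ s = 0 ∧
      1 - τ₁ * a₁ * Complex.exp (-s * τ₁) - τ₂ * a₂ * Complex.exp (-s * τ₂) = 0 ∧
      τ₁ ^ 2 * a₁ * Complex.exp (-s * τ₁) + τ₂ ^ 2 * a₂ * Complex.exp (-s * τ₂) = 0 := by
  have han := (charFunction_differentiable a₀ a₁ a₂ τ₁ τ₂).analyticAt s
  have hi := (natCast_le_analyticOrderAt_iff_iteratedDeriv_eq_zero (n := 3) han).1 (by simp [h])
  have hd : deriv (charFunction a₀ a₁ a₂ τ₁ τ₂) =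
      fun s => 1 - τ₁ * a₁ * Complex.exp (-s * τ₁) - τ₂ * a₂ * Complex.exp (-s * τ₂) :=
    funext fun s => (charFunction_hasDerivAt a₀ a₁ a₂ τ₁ τ₂ s).deriv
  have h0 := hi 0 (by norm_num)
  have h1 := hi 1 (by norm_num)
  have h2 := hi 2 (by norm_num)
  rw [iteratedDeriv_zero] at h0
  rw [iteratedDeriv_one, hd] at h1
  rw [iteratedDeriv_succ, iteratedDeriv_one, hd] at h2
  refine ⟨h0, h1, ?_⟩
  have h (τ : ℂ) : HasDerivAt (fun s : ℂ => Complex.exp (-s * τ))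
      (Complex.exp (-s * τ) * (-1 * τ)) s := ((hasDerivAt_id s).neg.mul_const τ).cexp
  have h3 := (((h τ₁).const_mul (τ₁ * a₁ : ℂ)).const_sub 1).sub ((h τ₂).const_mul (τ₂ * a₂ : ℂ))
  have h4 := h3.deriv.symm.trans h2
  linear_combination h4

theorem isStrictlyDominantRoot_of_order_three {a₀ a₁ a₂ τ₁ τ₂ s₀ : ℝ} (hτ₁ : 0 < τ₁)
    (hτ : τ₁ < τ₂) (hmult : analyticOrderAt (charFunction a₀ a₁ a₂ τ₁ τ₂) (s₀ : ℂ) = 3) :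
    IsStrictlyDominantRoot (charFunction a₀ a₁ a₂ τ₁ τ₂) s₀ := by
  obtain ⟨h0, h1, h2⟩ := charFunction_triple_root hmult
  refine ⟨h0, fun s hs => ?_⟩
  by_contra! hcon
  obtain ⟨hne, hre⟩ := hcon
  set w : ℂ := s - s₀ with hw
  have hτ₁' : (τ₁ : ℂ) ≠ 0 := by exact_mod_cast hτ₁.ne'
  have hτ₂ : 0 < τ₂ := hτ₁.trans hτ
  have hτ₂' : (τ₂ : ℂ) ≠ 0 := by exact_mod_cast hτ₂.ne'
  have hexp (τ : ℂ) : Complex.exp (-s * τ) = Complex.exp (-s₀ * τ) * Complex.exp (-(τ * w)) := by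
    rw [← Complex.exp_add, hw]; congr 1; ring
  rw [charFunction] at h0 hs
  rw [hexp, hexp] at hs
  set A₁ : ℂ := a₁ * Complex.exp (-s₀ * τ₁)
  set A₂ : ℂ := a₂ * Complex.exp (-s₀ * τ₂)
  have h2' : (τ₁ : ℂ) ^ 2 * A₁ = -(τ₂ ^ 2 * A₂) := by linear_combination h2
  -- Otherwise `A₂ = 0` too, and `Δ' s₀ = 1`.
  have hA₁ : A₁ ≠ 0 := by
    intro h
    have hA₂ : A₂ = 0 := by simpa [h, hτ₂'] using h2'
    have : (1 : ℂ) - τ₁ * A₁ - τ₂ * A₂ = 0 := by linear_combination h1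
    simp [h, hA₂] at this
  have hrel : (τ₂ : ℂ) ^ 2 * (Complex.exp (-(τ₁ * w)) - 1 + τ₁ * w)
      = τ₁ ^ 2 * (Complex.exp (-(τ₂ * w)) - 1 + τ₂ * w) := by
    apply mul_left_cancel₀ hA₁
    -- This is `Δ s - Δ s₀ - w Δ' s₀ = 0`: the terms linear in `w` outside `h` cancel.
    have : A₁ * (Complex.exp (-(τ₁ * w)) - 1 + τ₁ * w)
        + A₂ * (Complex.exp (-(τ₂ * w)) - 1 + τ₂ * w) = 0 := by
      rw [hw] at hs ⊢
      linear_combination hs - h0 - (s - s₀) * h1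
    linear_combination τ₂ ^ 2 * this - (Complex.exp (-(τ₂ * w)) - 1 + τ₂ * w) * h2'
  have hnorm := congrArg Complex.normSq hrel
  rw [map_mul, map_mul, map_pow, map_pow, Complex.normSq_ofReal, Complex.normSq_ofReal] at hnorm
  have hu : 0 ≤ w.re := by simpa [hw] using hre
  have huv : w.re ≠ 0 ∨ w.im ≠ 0 := by
    by_contra! h
    exact hne (sub_eq_zero.1 (Complex.ext h.1 h.2))
  apply remainderRatio_ne hu huv hτ₁ hτ
  rw [← normSq_exp_neg_sub_one_add, ← normSq_exp_neg_sub_one_add,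
    div_eq_div_iff (by positivity) (by positivity)]
  linear_combination hnorm

/-! ### Contour shift and a lower bound for `Δ`. -/

open MeasureTheory Filter Topology

/-- The integral of a holomorphic function along a vertical line does not depend on the line, as
long as the function decays quadratically in the strip between the lines. -/
lemma integral_vertical_line_eq {g : ℂ → ℂ} {σ₁ σ₂ C : ℝ} (hσ : σ₁ ≤ σ₂)
    (hd : DifferentiableOn ℂ g {s | σ₁ ≤ s.re ∧ s.re ≤ σ₂})
    (hb : ∀ s : ℂ, σ₁ ≤ s.re → s.re ≤ σ₂ → ‖g s‖ ≤ C * (1 + s.im ^ 2)⁻¹) :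
    ∫ y : ℝ, g (σ₁ + y * Complex.I) = ∫ y : ℝ, g (σ₂ + y * Complex.I) := by
  have hint : ∀ σ : ℝ, σ₁ ≤ σ → σ ≤ σ₂ → Integrable fun y : ℝ => g (σ + y * Complex.I) := by
    intro σ h1 h2
    refine (integrable_inv_one_add_sq.const_mul C).mono' ?_ (ae_of_all _ fun y => ?_)
    · refine Continuous.aestronglyMeasurable ?_
      refine hd.continuousOn.comp_continuous (by fun_prop) fun y => ?_
      simpa using ⟨h1, h2⟩
    · simpa using hb (σ + y * Complex.I) (by simpa using h1) (by simpa using h2)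
  -- The values `ε = 1` and `ε = -1` are the top and bottom sides of the rectangle `[σ₁, σ₂] × [-T,
  -- T]`.
  have hhor : ∀ ε : ℝ, ε ^ 2 = 1 →
      Tendsto (fun T : ℝ => ∫ x in σ₁..σ₂, g (x + (ε * T : ℝ) * Complex.I)) atTop (𝓝 0) := by
    intro ε hε
    have hlim : Tendsto (fun T : ℝ => C * (1 + T ^ 2)⁻¹ * |σ₂ - σ₁|) atTop (𝓝 0) := by
      have : Tendsto (fun T : ℝ => (1 + T ^ 2)⁻¹) atTop (𝓝 0) :=
        tendsto_inv_atTop_zero.comp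
          (tendsto_atTop_add_const_left _ _ (tendsto_pow_atTop two_ne_zero))
      simpa using (this.const_mul C).mul_const |σ₂ - σ₁|
    refine squeeze_zero_norm (fun T => ?_) hlim
    refine intervalIntegral.norm_integral_le_of_norm_le_const fun x hx => ?_
    rw [Set.uIoc_of_le hσ] at hx
    have := hb (x + (ε * T : ℝ) * Complex.I) (by simpa using hx.1.le) (by simpa using hx.2)
    simpa [mul_pow, hε] using this
  have hver : ∀ σ : ℝ, σ₁ ≤ σ → σ ≤ σ₂ →
      Tendsto (fun T : ℝ => ∫ y in (-T)..T, g (σ + y * Complex.I)) atTop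
        (𝓝 (∫ y : ℝ, g (σ + y * Complex.I))) := fun σ h1 h2 =>
    intervalIntegral_tendsto_integral (hint σ h1 h2) tendsto_neg_atTop_atBot tendsto_id
  have hrect : ∀ T : ℝ, (∫ x in σ₁..σ₂, g (x + (-1 * T : ℝ) * Complex.I))
      - (∫ x in σ₁..σ₂, g (x + (1 * T : ℝ) * Complex.I))
      + Complex.I • (∫ y in (-T)..T, g (σ₂ + y * Complex.I))
      - Complex.I • (∫ y in (-T)..T, g (σ₁ + y * Complex.I)) = 0 := by
    intro T
    have := Complex.integral_boundary_rect_eq_zero_of_differentiableOn g ⟨σ₁, -T⟩ ⟨σ₂, T⟩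
      (hd.mono fun s hs => by
        rw [Complex.mem_reProdIm, Set.uIcc_of_le hσ] at hs
        exact hs.1)
    simpa using this
  have hlim := (((hhor (-1) (by norm_num)).sub (hhor 1 (by norm_num))).add
    ((hver σ₂ hσ le_rfl).const_smul Complex.I)).sub ((hver σ₁ le_rfl hσ).const_smul Complex.I)
  have h0 := tendsto_nhds_unique (hlim.congr hrect) tendsto_const_nhds
  rw [sub_zero, zero_add, ← smul_sub, smul_eq_zero] at h0
  exact (sub_eq_zero.1 (h0.resolve_left Complex.I_ne_zero)).symm

/-- In the half-plane the exponentials are bounded, so `|Δ s| ≥ |s| - D`, which is at least `(1 +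
|s|) / 2` once `|s| ≥ 2 D + 1`. The rest of the half-plane is compact and free of zeros. -/
lemma exists_mul_one_add_norm_le_norm_charFunction {a₀ a₁ a₂ τ₁ τ₂ σ : ℝ} (hτ₁ : 0 ≤ τ₁)
    (hτ₂ : 0 ≤ τ₂) (hne : ∀ s : ℂ, σ ≤ s.re → charFunction a₀ a₁ a₂ τ₁ τ₂ s ≠ 0) :
    ∃ c > 0, ∀ s : ℂ, σ ≤ s.re → c * (1 + ‖s‖) ≤ ‖charFunction a₀ a₁ a₂ τ₁ τ₂ s‖ := by
  set D : ℝ := |a₀| + |a₁| * Real.exp (-σ * τ₁) + |a₂| * Real.exp (-σ * τ₂) with hD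
  have hD0 : 0 ≤ D := by positivity
  have hlarge : ∀ s : ℂ, σ ≤ s.re → ‖s‖ - D ≤ ‖charFunction a₀ a₁ a₂ τ₁ τ₂ s‖ := by
    intro s hs
    have hexp : ∀ τ : ℝ, 0 ≤ τ → ‖Complex.exp (-s * τ)‖ ≤ Real.exp (-σ * τ) := by
      intro τ hτ
      rw [Complex.norm_exp]
      have := mul_le_mul_of_nonneg_right hs hτ
      simpa using this
    have hsplit : s = charFunction a₀ a₁ a₂ τ₁ τ₂ s
        - (a₀ + a₁ * Complex.exp (-s * τ₁) + a₂ * Complex.exp (-s * τ₂)) := by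
      rw [charFunction]; ring
    have h1 : ‖(a₀ : ℂ) + a₁ * Complex.exp (-s * τ₁) + a₂ * Complex.exp (-s * τ₂)‖ ≤ D := by
      refine (norm_add₃_le).trans ?_
      rw [norm_mul, norm_mul, Complex.norm_real, Complex.norm_real, Complex.norm_real,
        Real.norm_eq_abs, Real.norm_eq_abs, Real.norm_eq_abs, hD]
      gcongr
      · exact hexp τ₁ hτ₁
      · exact hexp τ₂ hτ₂
    have h2 := norm_sub_le (charFunction a₀ a₁ a₂ τ₁ τ₂ s)
      (a₀ + a₁ * Complex.exp (-s * τ₁) + a₂ * Complex.exp (-s * τ₂))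
    rw [← hsplit] at h2
    linarith
  have hK : IsCompact (Metric.closedBall (0 : ℂ) (2 * D + 1) ∩ {s : ℂ | σ ≤ s.re}) :=
    (isCompact_closedBall _ _).inter_right (isClosed_le continuous_const Complex.continuous_re)
  have hpos : ∀ s : ℂ, 0 < 1 + ‖s‖ := fun s => by positivity
  obtain ⟨c, hc, hcle⟩ : ∃ c > 0, ∀ s ∈ Metric.closedBall (0 : ℂ) (2 * D + 1) ∩ {s : ℂ | σ ≤ s.re},
      c ≤ ‖charFunction a₀ a₁ a₂ τ₁ τ₂ s‖ / (1 + ‖s‖) := by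
    refine hK.exists_forall_le' (a := 0) ?_ fun s hs => ?_
    · exact ((charFunction_differentiable a₀ a₁ a₂ τ₁ τ₂).continuous.norm.div
        (by fun_prop) fun s => (hpos s).ne').continuousOn
    · exact div_pos (norm_pos_iff.2 (hne s hs.2)) (hpos s)
  refine ⟨min c (1 / 2), by positivity, fun s hs => ?_⟩
  by_cases hball : ‖s‖ ≤ 2 * D + 1
  · have := hcle s ⟨by simpa using hball, hs⟩
    rw [le_div_iff₀ (hpos s)] at this
    exact (mul_le_mul_of_nonneg_right (min_le_left _ _) (hpos s).le).trans this
  · have h1 := hlarge s hs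
    have h2 := mul_le_mul_of_nonneg_right (min_le_right c (1 / 2)) (hpos s).le
    linarith

/-! ### Laplace transform. -/

/-- The two-sided Laplace transform. -/
noncomputable def laplace (f : ℝ → ℂ) (s : ℂ) : ℂ := ∫ t : ℝ, f t * Complex.exp (-s * t)

lemma integrable_laplace_of_exp_bound {f : ℝ → ℂ} {C M : ℝ} {s : ℂ} (hf : Continuous f)
    (h0 : ∀ t ≤ 0, f t = 0) (hb : ∀ t, ‖f t‖ ≤ C * Real.exp (M * t)) (hs : M < s.re) :
    Integrable fun t : ℝ => f t * Complex.exp (-s * t) := by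
  have hon : IntegrableOn (fun t : ℝ => f t * Complex.exp (-s * t)) (Set.Ioi 0) := by
    refine Integrable.mono' ((integrableOn_exp_mul_Ioi (a := M - s.re) (by linarith) 0).const_mul C)
      (by fun_prop) (ae_of_all _ fun t => ?_)
    rw [norm_mul, Complex.norm_exp]
    refine (mul_le_mul_of_nonneg_right (hb t) (Real.exp_pos _).le).trans_eq ?_
    rw [mul_assoc, ← Real.exp_add]
    congr 2
    simp
    ring
  refine (integrableOn_iff_integrable_of_support_subset fun t ht => ?_).1 hon
  by_contra h
  exact ht (by simp [h0 t (not_lt.1 h)])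

lemma hasCompactSupport_of_Ioo {f : ℝ → ℂ} {T : ℝ} (h0 : ∀ t ∉ Set.Ioo 0 T, f t = 0) :
    HasCompactSupport f :=
  HasCompactSupport.intro (isCompact_Icc (a := 0) (b := T))
    fun t ht => h0 t fun h => ht (Set.Ioo_subset_Icc_self h)

lemma integrable_laplace_of_Ioo {f : ℝ → ℂ} {T : ℝ} (hf : Continuous f)
    (h0 : ∀ t ∉ Set.Ioo 0 T, f t = 0) (s : ℂ) :
    Integrable fun t : ℝ => f t * Complex.exp (-s * t) :=
  (by fun_prop : Continuous fun t : ℝ => f t * Complex.exp (-s * t)).integrable_of_hasCompactSupport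
    (hasCompactSupport_of_Ioo h0).mul_right

lemma laplace_deriv {f f' : ℝ → ℂ} {s : ℂ} (hd : ∀ t, HasDerivAt f (f' t) t)
    (hf : Integrable fun t : ℝ => f t * Complex.exp (-s * t))
    (hf' : Integrable fun t : ℝ => f' t * Complex.exp (-s * t)) :
    laplace f' s = s * laplace f s := by
  have he : ∀ t : ℝ, HasDerivAt (fun t : ℝ => Complex.exp (-s * t))
      (Complex.exp (-s * t) * (-s * 1)) t := fun t =>
    ((hasDerivAt_id t).ofReal_comp.const_mul (-s)).cexp
  have hd' : ∀ t : ℝ, HasDerivAt (fun t : ℝ => f t * Complex.exp (-s * t))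
      (f' t * Complex.exp (-s * t) - s * (f t * Complex.exp (-s * t))) t := fun t =>
    ((hd t).mul (he t)).congr_deriv (by ring)
  have := integral_eq_zero_of_hasDerivAt_of_integrable hd' (hf'.sub (hf.const_mul s)) hf
  rw [integral_sub hf' (hf.const_mul s), integral_const_mul] at this
  exact sub_eq_zero.1 this

lemma laplace_delay_integrand (f : ℝ → ℂ) (s : ℂ) (τ t : ℝ) :
    f (t - τ) * Complex.exp (-s * t)
      = Complex.exp (-s * τ) * (f (t - τ) * Complex.exp (-s * (t - τ : ℝ))) := by
  rw [mul_left_comm, ← Complex.exp_add]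
  congr 2
  push_cast
  ring

lemma integrable_laplace_delay {f : ℝ → ℂ} {s : ℂ} (τ : ℝ)
    (hf : Integrable fun t : ℝ => f t * Complex.exp (-s * t)) :
    Integrable fun t : ℝ => f (t - τ) * Complex.exp (-s * t) := by
  simp_rw [laplace_delay_integrand f s τ]
  exact (hf.comp_sub_right τ).const_mul _

lemma laplace_delay (f : ℝ → ℂ) (s : ℂ) (τ : ℝ) :
    laplace (fun t => f (t - τ)) s = Complex.exp (-s * τ) * laplace f s := by
  simp_rw [laplace, laplace_delay_integrand f s τ]
  rw [integral_const_mul, integral_sub_right_eq_self fun t : ℝ => f t * Complex.exp (-s * t)]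

lemma norm_laplace_le {f : ℝ → ℂ} {T B : ℝ} (hT : 0 ≤ T)
    (h0 : ∀ t ∉ Set.Ioo 0 T, f t = 0) (hB : ∀ t, ‖f t‖ ≤ B) (s : ℂ) :
    ‖laplace f s‖ ≤ B * T * Real.exp (|s.re| * T) := by
  have hB0 : 0 ≤ B := (norm_nonneg _).trans (hB 0)
  rw [laplace, ← setIntegral_eq_integral_of_forall_compl_eq_zero (s := Set.Ioo 0 T)
    fun t ht => by rw [h0 t ht, zero_mul]]
  have := norm_setIntegral_le_of_norm_le_const (μ := volume) (s := Set.Ioo 0 T)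
    (f := fun t : ℝ => f t * Complex.exp (-s * t)) (C := B * Real.exp (|s.re| * T))
    (by simp) fun t ht => by
      rw [norm_mul, Complex.norm_exp]
      refine mul_le_mul (hB t) (Real.exp_le_exp.2 ?_) (Real.exp_pos _).le hB0
      have h1 : (-s * (t : ℂ)).re = -s.re * t := by simp
      rw [h1]
      exact mul_le_mul (neg_le_abs _) ht.2.le ht.1.le (abs_nonneg _)
  simpa [measureReal_def, hT, mul_right_comm] using this

lemma differentiable_laplace {f : ℝ → ℂ} {T : ℝ} (hf : Continuous f)
    (h0 : ∀ t ∉ Set.Ioo 0 T, f t = 0) : Differentiable ℂ (laplace f) := by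
  intro s₀
  have hbound : Integrable fun t : ℝ => ‖f t‖ * (|t| * Real.exp ((‖s₀‖ + 1) * |t|)) :=
    (by fun_prop : Continuous fun t : ℝ => ‖f t‖ * (|t| * Real.exp ((‖s₀‖ + 1) * |t|)))
      |>.integrable_of_hasCompactSupport (hasCompactSupport_of_Ioo h0).norm.mul_right
  refine (hasDerivAt_integral_of_dominated_loc_of_deriv_le
    (F' := fun s t => f t * (Complex.exp (-s * t) * (-1 * t))) (Metric.ball_mem_nhds s₀ one_pos)
    (Eventually.of_forall fun s => by fun_prop) (integrable_laplace_of_Ioo hf h0 s₀)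
    (by fun_prop) (ae_of_all _ fun t s hs => ?_) hbound
    (ae_of_all _ fun t s _ => ?_)).2.differentiableAt
  · rw [norm_mul, norm_mul, Complex.norm_exp, mul_comm (Real.exp _)]
    have h1 : ‖-1 * (t : ℂ)‖ = |t| := by simp
    have h2 : (-s * (t : ℂ)).re ≤ (‖s₀‖ + 1) * |t| := by
      have h3 : ‖s‖ ≤ ‖s₀‖ + 1 := by
        have := norm_sub_norm_le s s₀
        have := mem_ball_iff_norm.1 hs
        linarith
      calc (-s * (t : ℂ)).re ≤ ‖-s * (t : ℂ)‖ := Complex.re_le_norm _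
        _ = ‖s‖ * |t| := by simp
        _ ≤ _ := by gcongr
    rw [h1]
    gcongr
  · exact (((hasDerivAt_id s).neg.mul_const (t : ℂ)).cexp).const_mul (f t)

/-! ### Laplace inversion for forced solutions. -/

/-- If the characteristic function has no zero in `Re s ≥ σ`, then every exponentially bounded
solution on `ℝ`, zero for `t ≤ 0`, of the equation with a `C¹` forcing term supported in `(0, T)` is
`O(exp (σ t))`, with a constant proportional to the supremum of the derivative of the forcing. -/
theorem exists_forced_solution_bound {a₀ a₁ a₂ τ₁ τ₂ σ T : ℝ} (hτ₁ : 0 ≤ τ₁) (hτ₂ : 0 ≤ τ₂)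
    (hT : 0 ≤ T) (hne : ∀ s : ℂ, σ ≤ s.re → charFunction a₀ a₁ a₂ τ₁ τ₂ s ≠ 0) :
    ∃ K : ℝ, 0 ≤ K ∧ ∀ (x r r' : ℝ → ℂ) (B C M : ℝ), (∀ t ≤ 0, x t = 0) →
      (∀ t, ‖x t‖ ≤ C * Real.exp (M * t)) →
      (∀ t, HasDerivAt x (r t - a₀ * x t - a₁ * x (t - τ₁) - a₂ * x (t - τ₂)) t) →
      (∀ t, HasDerivAt r (r' t) t) → Continuous r' → (∀ t ∉ Set.Ioo 0 T, r t = 0) →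
      (∀ t ∉ Set.Ioo 0 T, r' t = 0) → (∀ t, ‖r' t‖ ≤ B) →
      ∀ t, ‖x t‖ ≤ K * B * Real.exp (σ * t) := by
  obtain ⟨c, hc, hΔ⟩ := exists_mul_one_add_norm_le_norm_charFunction hτ₁ hτ₂ hne
  set Δ := charFunction a₀ a₁ a₂ τ₁ τ₂ with hΔdef
  -- `T * T` comes from bounding `laplace r` with `‖r‖ ≤ B T`, `T` from `laplace r'`, `c` from the
  -- lower bound for `Δ`, and `1 / 2` is `π / (2 π)` with `π = ∫ (1 + y²)⁻¹`.
  refine ⟨(T * T + T) * Real.exp (|σ| * T) / c / 2, by positivity, ?_⟩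
  intro x r r' B C M hx0 hxb hxd hrd hr'c hr0 hr'0 hr'b t
  have hB : 0 ≤ B := (norm_nonneg _).trans (hr'b 0)
  have hxc : Continuous x := continuous_iff_continuousAt.2 fun t => (hxd t).continuousAt
  have hrc : Continuous r := continuous_iff_continuousAt.2 fun t => (hrd t).continuousAt
  have hrb : ∀ t, ‖r t‖ ≤ B * T := by
    intro t
    by_cases ht : t ∈ Set.Ioo 0 T
    · have := convex_univ.norm_image_sub_le_of_norm_hasDerivWithin_le (f := r) (f' := r') (C := B)
        (fun t _ => (hrd t).hasDerivWithinAt) (fun t _ => hr'b t) (Set.mem_univ 0) (Set.mem_univ t)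
      rw [hr0 0 (by simp), sub_zero, sub_zero, Real.norm_eq_abs, abs_of_pos ht.1] at this
      exact this.trans (mul_le_mul_of_nonneg_left ht.2.le hB)
    · rw [hr0 t ht, norm_zero]; positivity
  -- One integration by parts, `s * laplace r s = laplace r' s`, gains the factor `1 / |s|`.
  have hrL : ∀ s : ℂ, (1 + ‖s‖) * ‖laplace r s‖ ≤ B * (T * T + T) * Real.exp (|s.re| * T) := by
    intro s
    have h1 := norm_laplace_le hT hr0 hrb s
    have h2 := norm_laplace_le hT hr'0 hr'b s
    rw [laplace_deriv hrd (integrable_laplace_of_Ioo hrc hr0 s)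
      (integrable_laplace_of_Ioo hr'c hr'0 s), norm_mul] at h2
    linarith
  have hquot : ∀ s : ℂ, σ ≤ s.re → ‖laplace r s / Δ s‖
      ≤ B * (T * T + T) * Real.exp (|s.re| * T) / c * (1 + s.im ^ 2)⁻¹ := by
    intro s hs
    have h1 : 0 < 1 + ‖s‖ := by positivity
    have h2 : 1 + s.im ^ 2 ≤ (1 + ‖s‖) * (1 + ‖s‖) := by
      have h3 := Complex.abs_im_le_norm s
      have h4 : s.im ^ 2 ≤ ‖s‖ ^ 2 := by
        rw [← sq_abs]; gcongr
      nlinarith [norm_nonneg s]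
    have h3 : 0 < ‖Δ s‖ := norm_pos_iff.2 (hne s hs)
    rw [norm_div, ← div_eq_mul_inv, div_div, div_le_div_iff₀ h3 (by positivity)]
    calc ‖laplace r s‖ * (c * (1 + s.im ^ 2))
        ≤ ‖laplace r s‖ * (c * ((1 + ‖s‖) * (1 + ‖s‖))) := by gcongr
      _ = ((1 + ‖s‖) * ‖laplace r s‖) * (c * (1 + ‖s‖)) := by ring
      _ ≤ _ := mul_le_mul (hrL s) (hΔ s hs) (by positivity) (by positivity)
  -- The transform of `x` is known to converge only to the right of `M`, whereas `laplace r / Δ` is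
  -- holomorphic near every point with `Re s ≥ σ`. Inversion takes place on `Re s = σ'`, and the
  -- line is then moved to `σ`.
  set σ' : ℝ := max σ (M + 1) with hσ'
  have hσσ' : σ ≤ σ' := le_max_left _ _
  have hlap : ∀ s : ℂ, s.re = σ' → laplace x s = laplace r s / Δ s := by
    intro s hs
    have hMs : M < s.re := by rw [hs, hσ']; exact (lt_add_one M).trans_le (le_max_right _ _)
    have hσs : σ ≤ s.re := by rw [hs]; exact le_max_left _ _
    have ix := integrable_laplace_of_exp_bound hxc hx0 hxb hMs
    have ir := integrable_laplace_of_Ioo hrc hr0 s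
    have i0 := ix.const_mul (a₀ : ℂ)
    have i1 := (integrable_laplace_delay τ₁ ix).const_mul (a₁ : ℂ)
    have i2 := (integrable_laplace_delay τ₂ ix).const_mul (a₂ : ℂ)
    have hsplit : ∀ t : ℝ, (r t - a₀ * x t - a₁ * x (t - τ₁) - a₂ * x (t - τ₂))
        * Complex.exp (-s * t) = r t * Complex.exp (-s * t) - a₀ * (x t * Complex.exp (-s * t))
          - a₁ * (x (t - τ₁) * Complex.exp (-s * t)) - a₂ * (x (t - τ₂) * Complex.exp (-s * t)) :=
      fun t => by ring
    have h1 := laplace_deriv hxd ix (by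
      simp_rw [hsplit]; exact ((ir.sub i0).sub i1).sub i2)
    have h2 : laplace (fun t => r t - a₀ * x t - a₁ * x (t - τ₁) - a₂ * x (t - τ₂)) s
        = laplace r s - a₀ * laplace x s - a₁ * laplace (fun t => x (t - τ₁)) s
          - a₂ * laplace (fun t => x (t - τ₂)) s := by
      simp_rw [laplace, hsplit]
      have j1 : Integrable fun t : ℝ => r t * Complex.exp (-s * t)
          - a₀ * (x t * Complex.exp (-s * t)) := ir.sub i0
      have j2 : Integrable fun t : ℝ => r t * Complex.exp (-s * t)
          - a₀ * (x t * Complex.exp (-s * t)) - a₁ * (x (t - τ₁) * Complex.exp (-s * t)) :=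
        j1.sub i1
      rw [integral_sub j2 i2, integral_sub j1 i1, integral_sub ir i0,
        integral_const_mul, integral_const_mul, integral_const_mul]
    rw [h2, laplace_delay, laplace_delay] at h1
    rw [eq_div_iff (hne s hσs), hΔdef, charFunction]
    linear_combination -h1
  have hRd : Differentiable ℂ (laplace r) := differentiable_laplace hrc hr0
  have hΔd : Differentiable ℂ Δ := charFunction_differentiable a₀ a₁ a₂ τ₁ τ₂
  -- Fourier inversion on the line with real part `max σ (M + 1)`.
  have hfi : Integrable fun t : ℝ => x t * Complex.exp (-(σ' : ℂ) * t) :=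
    integrable_laplace_of_exp_bound hxc hx0 hxb (by
      rw [Complex.ofReal_re, hσ']; exact (lt_add_one M).trans_le (le_max_right _ _))
  have hfourier : ∀ ξ : ℝ, FourierTransform.fourier (fun t : ℝ => x t * Complex.exp (-(σ' : ℂ) * t)) ξ
      = laplace r (σ' + (2 * Real.pi * ξ : ℝ) * Complex.I)
        / Δ (σ' + (2 * Real.pi * ξ : ℝ) * Complex.I) := by
    intro ξ
    rw [← hlap _ (by simp), laplace, Real.fourier_eq']
    refine integral_congr_ae (ae_of_all _ fun v => ?_)
    simp only [smul_eq_mul]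
    rw [mul_left_comm, ← Complex.exp_add]
    congr 2
    simp
    ring
  have hline : Continuous fun y : ℝ => laplace r (σ' + y * Complex.I) / Δ (σ' + y * Complex.I) :=
    (hRd.continuous.comp (by fun_prop)).div (hΔd.continuous.comp (by fun_prop)) fun y =>
      hne _ (by simpa using hσσ')
  have hlinei : Integrable fun y : ℝ =>
      laplace r (σ' + y * Complex.I) / Δ (σ' + y * Complex.I) := by
    refine (integrable_inv_one_add_sq.const_mul
      (B * (T * T + T) * Real.exp (|σ'| * T) / c)).mono' hline.aestronglyMeasurable
      (ae_of_all _ fun y => ?_)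
    simpa using hquot (σ' + y * Complex.I) (by simpa using hσσ')
  have hFi : Integrable (FourierTransform.fourier fun t : ℝ => x t * Complex.exp (-(σ' : ℂ) * t)) := by
    rw [funext hfourier]
    exact hlinei.comp_mul_left' (by positivity : (2 * Real.pi) ≠ 0)
  have hinv := hfi.fourierInv_fourier_eq hFi (v := t) (by fun_prop)
  rw [Real.fourierInv_eq'] at hinv
  set g : ℂ → ℂ := fun s => Complex.exp (s * t) * (laplace r s / Δ s) with hg
  have hxt : x t = (2 * Real.pi : ℝ)⁻¹ * ∫ y : ℝ, g (σ' + y * Complex.I) := by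
    have h1 : x t = Complex.exp (σ' * t) * (x t * Complex.exp (-(σ' : ℂ) * t)) := by
      rw [mul_left_comm, ← Complex.exp_add]; simp
    rw [h1, ← hinv, ← integral_const_mul]
    have h2 := Measure.integral_comp_mul_left (fun y : ℝ => g (σ' + y * Complex.I)) (2 * Real.pi)
    rw [abs_of_pos (by positivity), Complex.real_smul] at h2
    rw [← h2]
    refine integral_congr_ae (ae_of_all _ fun ξ => ?_)
    simp only [smul_eq_mul, hg]
    rw [hfourier, ← mul_assoc, ← Complex.exp_add]
    congr 2
    simp
    ring
  have hgb : ∀ s : ℂ, σ ≤ s.re → ‖g s‖ ≤ Real.exp (s.re * t) *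
      (B * (T * T + T) * Real.exp (|s.re| * T) / c) * (1 + s.im ^ 2)⁻¹ := by
    intro s hs
    rw [hg, mul_assoc, norm_mul, Complex.norm_exp]
    refine mul_le_mul (by simp) (hquot s hs) (norm_nonneg _) (Real.exp_pos _).le
  have hshift : ∫ y : ℝ, g (σ + y * Complex.I) = ∫ y : ℝ, g (σ' + y * Complex.I) := by
    refine integral_vertical_line_eq (C := Real.exp (max |σ| |σ'| * |t|) *
      (B * (T * T + T) * Real.exp (max |σ| |σ'| * T) / c)) (le_max_left _ _) ?_ ?_
    · intro s hs
      refine DifferentiableAt.differentiableWithinAt ?_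
      exact (by fun_prop : DifferentiableAt ℂ (fun s : ℂ => Complex.exp (s * t)) s).mul
        ((hRd s).div (hΔd s) (hne s hs.1))
    · intro s h1 h2
      have h3 : |s.re| ≤ max |σ| |σ'| := abs_le_max_abs_abs h1 h2
      refine (hgb s h1).trans ?_
      have h4 : s.re * t ≤ max |σ| |σ'| * |t| :=
        calc s.re * t ≤ |s.re * t| := le_abs_self _
          _ = |s.re| * |t| := abs_mul _ _
          _ ≤ _ := by gcongr
      gcongr
  rw [hxt, ← hshift, norm_mul, Complex.norm_real, Real.norm_eq_abs, abs_of_pos (by positivity)]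
  have hfin : ‖∫ y : ℝ, g (σ + y * Complex.I)‖ ≤ ∫ y : ℝ, Real.exp (σ * t) *
      (B * (T * T + T) * Real.exp (|σ| * T) / c) * (1 + y ^ 2)⁻¹ := by
    refine norm_integral_le_of_norm_le (integrable_inv_one_add_sq.const_mul _)
      (ae_of_all _ fun y => ?_)
    simpa using hgb (σ + y * Complex.I) (by simp)
  rw [integral_const_mul, integral_univ_inv_one_add_sq] at hfin
  calc (2 * Real.pi)⁻¹ * ‖∫ y : ℝ, g (σ + y * Complex.I)‖
      ≤ (2 * Real.pi)⁻¹ * (Real.exp (σ * t) *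
        (B * (T * T + T) * Real.exp (|σ| * T) / c) * Real.pi) := by gcongr
    _ = _ := by field_simp

/-! ### A priori growth of solutions. -/

/-- A solution for `t ≥ 0` of the delay equation, continuous on all of `ℝ` and bounded by `N` for
`t ≤ 0`. -/
structure IsBoundedHistorySolution (a₀ a₁ a₂ τ₁ τ₂ N : ℝ) (y : ℝ → ℝ) : Prop where
  continuous : Continuous y
  abs_le_of_nonpos : ∀ t ≤ 0, |y t| ≤ N
  equation : ∀ t : ℝ, 0 ≤ t →
    HasDerivWithinAt y (-(a₀ * y t + a₁ * y (t - τ₁) + a₂ * y (t - τ₂))) (Set.Ici 0) t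

/-- Freezing `y` at `y (-τ₂)` before `-τ₂` makes it continuous on `ℝ`; for `t ≥ 0` the equation
never looks further back. -/
lemma IsSolution.isBoundedHistorySolution {a₀ a₁ a₂ τ₁ τ₂ : ℝ} (hτ₂ : 0 ≤ τ₂) (hτ : τ₁ ≤ τ₂)
    {φ : C(Set.Icc (-τ₂) 0, ℝ)} {y : ℝ → ℝ} (hy : IsSolution a₀ a₁ a₂ τ₁ τ₂ φ y) :
    IsBoundedHistorySolution a₀ a₁ a₂ τ₁ τ₂ ‖φ‖ fun t => y (max t (-τ₂)) where
  continuous := hy.continuousOn.comp_continuous (by fun_prop) fun t => Set.mem_Ici.2 (le_max_right _ _)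
  abs_le_of_nonpos t ht := by
    have := φ.norm_coe_le_norm ⟨max t (-τ₂), le_max_right _ _, max_le ht (by linarith)⟩
    rwa [← hy.initial, Real.norm_eq_abs] at this
  equation t ht := by
    rw [max_eq_left (by linarith : -τ₂ ≤ t), max_eq_left (by linarith : -τ₂ ≤ t - τ₁),
      max_eq_left (by linarith : -τ₂ ≤ t - τ₂)]
    have hmax : ∀ u ∈ Set.Ici (0 : ℝ), y (max u (-τ₂)) = y u := fun u hu => by
      rw [max_eq_left ((neg_nonpos.2 hτ₂).trans hu)]
    exact (hy.equation t ht).congr hmax (hmax t ht)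

namespace IsBoundedHistorySolution

variable {a₀ a₁ a₂ τ₁ τ₂ N : ℝ} {y : ℝ → ℝ}

lemma nonneg (hy : IsBoundedHistorySolution a₀ a₁ a₂ τ₁ τ₂ N y) : 0 ≤ N :=
  (abs_nonneg _).trans (hy.abs_le_of_nonpos 0 le_rfl)

lemma abs_rhs_le {m t : ℝ} (h0 : |y t| ≤ m) (h1 : |y (t - τ₁)| ≤ m) (h2 : |y (t - τ₂)| ≤ m) :
    |-(a₀ * y t + a₁ * y (t - τ₁) + a₂ * y (t - τ₂))| ≤ (|a₀| + |a₁| + |a₂|) * m := by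
  rw [abs_neg]
  refine (abs_add_three _ _ _).trans ?_
  rw [abs_mul, abs_mul, abs_mul, add_mul, add_mul]
  gcongr

/-- A substitute for Grönwall's inequality with a step `h` independent of `T`. If the maximum `|y
u|` over `[T, T + h]` exceeded `2 m`, it would dominate the whole past, and the mean value
inequality would give `|y u| - m ≤ |y u| / 2`. -/
lemma abs_le_two_mul (hy : IsBoundedHistorySolution a₀ a₁ a₂ τ₁ τ₂ N y) (hτ₁ : 0 ≤ τ₁)
    (hτ₂ : 0 ≤ τ₂) {h T m : ℝ} (hh : 0 ≤ h) (hA : (|a₀| + |a₁| + |a₂|) * h ≤ 1 / 2) (hT : 0 ≤ T)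
    (hm : ∀ t ≤ T, |y t| ≤ m) : ∀ t ≤ T + h, |y t| ≤ 2 * m := by
  have hm0 : 0 ≤ m := (abs_nonneg _).trans (hm T le_rfl)
  obtain ⟨u, hu, hmax⟩ := isCompact_Icc.exists_isMaxOn (Set.nonempty_Icc.2 (by linarith : T ≤ T + h))
    hy.continuous.abs.continuousOn
  have hum : |y u| ≤ 2 * m := by
    by_contra! hcon
    have hall : ∀ t ≤ T + h, |y t| ≤ |y u| := fun t ht => by
      rcases le_total t T with h | h
      · linarith [hm t h]
      · exact hmax ⟨h, ht⟩
    have hderiv := (convex_Icc T (T + h)).norm_image_sub_le_of_norm_hasDerivWithin_le (f := y)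
      (C := (|a₀| + |a₁| + |a₂|) * |y u|) (x := T) (y := u)
      (fun t ht => (hy.equation t (hT.trans ht.1)).mono
        fun v hv => hT.trans hv.1)
      (fun t ht => abs_rhs_le (hall _ ht.2) (hall _ (by linarith [ht.2]))
        (hall _ (by linarith [ht.2]))) (Set.left_mem_Icc.2 (by linarith)) hu
    rw [Real.norm_eq_abs, Real.norm_eq_abs, abs_of_nonneg (sub_nonneg.2 hu.1)] at hderiv
    have h1 : (|a₀| + |a₁| + |a₂|) * |y u| * (u - T) ≤ |y u| / 2 := by
      have : (|a₀| + |a₁| + |a₂|) * (u - T) ≤ 1 / 2 :=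
        (mul_le_mul_of_nonneg_left (by linarith [hu.2]) (by positivity)).trans hA
      nlinarith [abs_nonneg (y u)]
    have h2 := abs_sub_abs_le_abs_sub (y u) (y T)
    have h3 := hm T le_rfl
    linarith
  intro t ht
  rcases le_total t T with h | h
  · linarith [hm t h]
  · exact (hmax ⟨h, ht⟩).trans hum

/-- The bound doubles on each step of length `M⁻¹`. The crude rate suffices: it makes the Laplace
transform converge and controls `y` on bounded intervals. -/
lemma abs_le_exp (hy : IsBoundedHistorySolution a₀ a₁ a₂ τ₁ τ₂ N y) (hτ₁ : 0 ≤ τ₁)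
    (hτ₂ : 0 ≤ τ₂) {t : ℝ} (ht : 0 ≤ t) :
    |y t| ≤ 2 * N * Real.exp ((2 * (|a₀| + |a₁| + |a₂|) + 1) * t) := by
  set M := 2 * (|a₀| + |a₁| + |a₂|) + 1 with hM
  have hM0 : 0 < M := by positivity
  have hA : (|a₀| + |a₁| + |a₂|) * M⁻¹ ≤ 1 / 2 := by
    rw [← div_eq_mul_inv, div_le_iff₀ hM0]; linarith
  have hstep : ∀ n : ℕ, ∀ t ≤ n * M⁻¹, |y t| ≤ 2 ^ n * N := by
    intro n
    induction n with
    | zero => simpa using hy.abs_le_of_nonpos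
    | succ n ih =>
      intro t ht
      rw [pow_succ', mul_assoc]
      refine hy.abs_le_two_mul hτ₁ hτ₂ (by positivity) hA (by positivity) ih t (ht.trans_eq ?_)
      push_cast
      ring
  have hn : t ≤ ⌈M * t⌉₊ * M⁻¹ := by
    rw [← div_eq_mul_inv, le_div_iff₀ hM0, mul_comm]
    exact Nat.le_ceil _
  refine (hstep _ t hn).trans ?_
  have h2 : (2 : ℝ) ≤ Real.exp 1 := by have := Real.add_one_le_exp (1 : ℝ); linarith
  have h3 : (2 : ℝ) ^ ⌈M * t⌉₊ ≤ 2 * Real.exp (M * t) := by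
    have hlt : (⌈M * t⌉₊ : ℝ) < M * t + 1 := Nat.ceil_lt_add_one (by positivity)
    rcases Nat.eq_zero_or_pos ⌈M * t⌉₊ with h | h
    · rw [h, pow_zero]
      have := Real.one_le_exp (by positivity : 0 ≤ M * t)
      linarith
    · obtain ⟨k, hk⟩ := Nat.exists_eq_succ_of_ne_zero h.ne'
      rw [hk] at hlt ⊢
      rw [pow_succ']
      refine mul_le_mul_of_nonneg_left ?_ zero_le_two
      calc (2 : ℝ) ^ k ≤ Real.exp 1 ^ k := by gcongr
        _ = Real.exp k := by rw [← Real.exp_nat_mul, mul_one]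
        _ ≤ _ := Real.exp_le_exp.2 (by push_cast at hlt; linarith)
  have := mul_le_mul_of_nonneg_right h3 hy.nonneg
  linarith

lemma abs_le_of_le (hy : IsBoundedHistorySolution a₀ a₁ a₂ τ₁ τ₂ N y) (hτ₁ : 0 ≤ τ₁)
    (hτ₂ : 0 ≤ τ₂) {t T : ℝ} (hT : 0 ≤ T) (ht : t ≤ T) :
    |y t| ≤ 2 * N * Real.exp ((2 * (|a₀| + |a₁| + |a₂|) + 1) * T) := by
  have hN := hy.nonneg
  rcases le_total t 0 with h | h
  · have h1 := hy.abs_le_of_nonpos t h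
    have h2 := Real.one_le_exp (by positivity : 0 ≤ (2 * (|a₀| + |a₁| + |a₂|) + 1) * T)
    nlinarith
  · refine (hy.abs_le_exp hτ₁ hτ₂ h).trans ?_
    gcongr

/-! ### Smooth cutoffs of solutions. -/

/-- Multiplying a delayed solution by a `C¹` function which vanishes for small times yields a
function differentiable everywhere. -/
lemma hasDerivAt_cutoff_mul (hy : IsBoundedHistorySolution a₀ a₁ a₂ τ₁ τ₂ N y) {κ : ℝ → ℝ}
    {τ T : ℝ} (hκ : ContDiff ℝ 1 κ) (h0 : ∀ t ≤ T, κ t = 0) (hτ : τ < T) (t : ℝ) :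
    HasDerivAt (fun t => κ t * y (t - τ)) (deriv κ t * y (t - τ)
      + κ t * -(a₀ * y (t - τ) + a₁ * y (t - τ - τ₁) + a₂ * y (t - τ - τ₂))) t := by
  have hd : HasDerivAt κ (deriv κ t) t := (hκ.differentiable one_ne_zero t).hasDerivAt
  rcases lt_or_ge τ t with ht | ht
  · have hpos : 0 < t - τ := sub_pos.2 ht
    have h1 : HasDerivAt y (-(a₀ * y (t - τ) + a₁ * y (t - τ - τ₁) + a₂ * y (t - τ - τ₂))) (t - τ) :=
      (hy.equation (t - τ) hpos.le).hasDerivAt (Ici_mem_nhds hpos)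
    exact hd.mul (h1.comp_sub_const t τ)
  -- The possible kink of `y (· - τ)` at `τ`, and all of its history part, lie where `κ` vanishes
  -- identically.
  · have hev : ∀ᶠ u in 𝓝 t, κ u = 0 := by
      filter_upwards [Iio_mem_nhds (ht.trans_lt hτ)] with u hu using h0 u (le_of_lt hu)
    have hd0 : deriv κ t = 0 := by
      rw [EventuallyEq.deriv_eq (f := fun _ => (0 : ℝ)) hev, deriv_const]
    rw [hd0, h0 t (ht.trans hτ.le), zero_mul, zero_mul, add_zero]
    refine (hasDerivAt_const t (0 : ℝ)).congr_of_eventuallyEq ?_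
    filter_upwards [hev] with u hu
    rw [hu, zero_mul]

end IsBoundedHistorySolution

lemma deriv_eq_zero_of_notMem_Ioo {κ : ℝ → ℝ} {b c T : ℝ} (hb : 0 < b) (hc : c < T)
    (h0 : ∀ t ≤ b, κ t = 0) (h1 : ∀ t, c ≤ t → κ t = 0) {t : ℝ} (ht : t ∉ Set.Ioo 0 T) :
    deriv κ t = 0 := by
  have hev : κ =ᶠ[𝓝 t] fun _ => 0 := by
    rcases lt_or_ge t b with h | h
    · filter_upwards [Iio_mem_nhds h] with u hu using h0 u (le_of_lt hu)
    · have : c < t := by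
        by_contra! hct
        exact ht ⟨hb.trans_le h, hct.trans_lt hc⟩
      filter_upwards [Ioi_mem_nhds this] with u hu using h1 u (le_of_lt hu)
  rw [hev.deriv_eq, deriv_const]

/-- A `C¹` cutoff of a delayed solution is a `C¹` function whose derivative is bounded in terms of
the history of the solution. -/
lemma exists_cutoff_mul_bound (a₀ a₁ a₂ : ℝ) {τ₁ τ₂ τ b c T : ℝ} {κ : ℝ → ℝ} (hτ₁ : 0 ≤ τ₁)
    (hτ₂ : 0 ≤ τ₂) (hτ : 0 ≤ τ) (hτb : τ < b) (hcT : c < T) (hT : 0 ≤ T) (hκ : ContDiff ℝ 1 κ)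
    (h0 : ∀ t ≤ b, κ t = 0) (h1 : ∀ t, c ≤ t → κ t = 0) :
    ∃ B : ℝ, ∀ (N : ℝ) (y : ℝ → ℝ), IsBoundedHistorySolution a₀ a₁ a₂ τ₁ τ₂ N y →
      ∃ f : ℝ → ℝ, (∀ t, HasDerivAt (fun t => κ t * y (t - τ)) (f t) t) ∧ Continuous f ∧
        (∀ t ∉ Set.Ioo 0 T, κ t * y (t - τ) = 0) ∧ (∀ t ∉ Set.Ioo 0 T, f t = 0) ∧
        ∀ t, |f t| ≤ B * N := by
  have hb : 0 < b := hτ.trans_lt hτb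
  have hκ0 : ∀ t ∉ Set.Ioo 0 T, κ t = 0 := by
    intro t ht
    rcases le_total t b with h | h
    · exact h0 t h
    · refine h1 t ?_
      by_contra! hct
      exact ht ⟨hb.trans_le h, hct.trans hcT⟩
  have hκ'0 : ∀ t ∉ Set.Ioo 0 T, deriv κ t = 0 := fun t ht =>
    deriv_eq_zero_of_notMem_Ioo hb hcT h0 h1 ht
  have hκ'c : Continuous (deriv κ) := hκ.continuous_deriv le_rfl
  obtain ⟨k₀, hk₀⟩ := isCompact_Icc (a := (0 : ℝ)) (b := T) |>.exists_bound_of_continuousOn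
    hκ.continuous.continuousOn
  obtain ⟨k₁, hk₁⟩ := isCompact_Icc (a := (0 : ℝ)) (b := T) |>.exists_bound_of_continuousOn
    hκ'c.continuousOn
  have hk₀0 : 0 ≤ k₀ := (norm_nonneg _).trans (hk₀ 0 ⟨le_rfl, hT⟩)
  have hk₁0 : 0 ≤ k₁ := (norm_nonneg _).trans (hk₁ 0 ⟨le_rfl, hT⟩)
  set E := Real.exp ((2 * (|a₀| + |a₁| + |a₂|) + 1) * T)
  refine ⟨(k₁ + k₀ * (|a₀| + |a₁| + |a₂|)) * (2 * E), fun N y hy => ?_⟩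
  have hyc := hy.continuous
  have hN := hy.nonneg
  refine ⟨fun t => deriv κ t * y (t - τ)
      + κ t * -(a₀ * y (t - τ) + a₁ * y (t - τ - τ₁) + a₂ * y (t - τ - τ₂)),
    hy.hasDerivAt_cutoff_mul hκ h0 hτb, ?_, fun t ht => by rw [hκ0 t ht, zero_mul],
    fun t ht => by simp only [hκ0 t ht, hκ'0 t ht, zero_mul, add_zero], fun t => ?_⟩
  · have := hκ.continuous
    fun_prop
  · by_cases ht : t ∈ Set.Ioo 0 T
    · have hle : ∀ u ≤ T, |y u| ≤ 2 * N * E := fun u hu => hy.abs_le_of_le hτ₁ hτ₂ hT hu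
      have ht2 := ht.2
      have e0 := hle (t - τ) (by linarith)
      have e1 := IsBoundedHistorySolution.abs_rhs_le (a₀ := a₀) (a₁ := a₁) (a₂ := a₂) e0
        (hle (t - τ - τ₁) (by linarith)) (hle (t - τ - τ₂) (by linarith))
      have e2 := hk₀ t (Set.Ioo_subset_Icc_self ht)
      have e3 := hk₁ t (Set.Ioo_subset_Icc_self ht)
      rw [Real.norm_eq_abs] at e2 e3
      refine (abs_add_le _ _).trans ?_
      rw [abs_mul, abs_mul]
      calc _ ≤ k₁ * (2 * N * E) + k₀ * ((|a₀| + |a₁| + |a₂|) * (2 * N * E)) := by gcongr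
        _ = _ := by ring
    · simp only [hκ0 t ht, hκ'0 t ht, zero_mul, add_zero, abs_zero]
      positivity

/-! ### Exponential bounds and stability. -/

/-- If the characteristic function has no zero in `Re s ≥ σ`, then solutions of the delay equation
are `O(exp (σ t))`, uniformly in the initial datum. -/
theorem exists_solution_bound {a₀ a₁ a₂ τ₁ τ₂ σ : ℝ} (hτ₁ : 0 ≤ τ₁) (hτ₂ : 0 < τ₂) (hτ : τ₁ ≤ τ₂)
    (hne : ∀ s : ℂ, σ ≤ s.re → charFunction a₀ a₁ a₂ τ₁ τ₂ s ≠ 0) :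
    ∃ K : ℝ, ∀ (N : ℝ) (y : ℝ → ℝ), IsBoundedHistorySolution a₀ a₁ a₂ τ₁ τ₂ N y →
      ∀ t : ℝ, 0 ≤ t → |y t| ≤ K * Real.exp (σ * t) * N := by
  -- `χ` rises from `0` at `2 τ₂` to `1` at `3 τ₂`. Then `χ y` solves the equation with forcing `χ'
  -- y + ∑ aᵢ (χ(t - τᵢ) - χ t) y(t - τᵢ)`, supported in `[2 τ₂, 4 τ₂]`. There `t - τᵢ ≥ τ₂ > 0`, so
  -- `y` is evaluated only where it is differentiable and the forcing is `C¹`.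
  set χ : ℝ → ℝ := fun t => Real.smoothTransition (t / τ₂ - 2) with hχ
  have hχs : ContDiff ℝ (⊤ : ℕ∞) χ :=
    Real.smoothTransition.contDiff.comp ((contDiff_id.div_const τ₂).sub contDiff_const)
  have hχ0 : ∀ t ≤ 2 * τ₂, χ t = 0 := fun t ht =>
    Real.smoothTransition.zero_of_nonpos (by rw [sub_nonpos, div_le_iff₀ hτ₂]; exact ht)
  have hχ1 : ∀ t, 3 * τ₂ ≤ t → χ t = 1 := fun t ht =>
    Real.smoothTransition.one_of_one_le (by
      have : 3 ≤ t / τ₂ := (le_div_iff₀ hτ₂).2 ht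
      linarith)
  have hχ' : ContDiff ℝ 1 (deriv χ) :=
    (contDiff_infty_iff_deriv.1 hχs).2.of_le (by exact_mod_cast le_top)
  have hχ1s : ContDiff ℝ 1 χ := hχs.of_le (by exact_mod_cast le_top)
  have hχ'0 : ∀ t ≤ 2 * τ₂, deriv χ t = 0 := by
    have hlt : Set.EqOn (deriv χ) (fun _ => 0) (Set.Iio (2 * τ₂)) := fun t ht => by
      have hev : χ =ᶠ[𝓝 t] fun _ => 0 := by
        filter_upwards [Iio_mem_nhds ht] with u hu using hχ0 u (le_of_lt hu)
      rw [hev.deriv_eq, deriv_const]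
    have := hlt.closure hχ'.continuous continuous_const
    rwa [closure_Iio] at this
  have hχ'1 : ∀ t, 4 * τ₂ ≤ t → deriv χ t = 0 := fun t ht => by
    have hev : χ =ᶠ[𝓝 t] fun _ => 1 := by
      filter_upwards [Ioi_mem_nhds (by linarith : 3 * τ₂ < t)] with u hu using hχ1 u (le_of_lt hu)
    rw [hev.deriv_eq, deriv_const]
  have hκs : ∀ τ : ℝ, ContDiff ℝ 1 fun t => χ (t - τ) - χ t := fun τ =>
    (hχ1s.comp (contDiff_id.sub contDiff_const)).sub hχ1s
  have hκ0 : ∀ τ : ℝ, 0 ≤ τ → ∀ t ≤ 2 * τ₂, χ (t - τ) - χ t = 0 := fun τ hτ t ht => by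
    rw [hχ0 t ht, hχ0 (t - τ) (by linarith), sub_zero]
  have hκ1 : ∀ τ : ℝ, 0 ≤ τ → τ ≤ τ₂ → ∀ t, 4 * τ₂ ≤ t → χ (t - τ) - χ t = 0 :=
    fun τ _ hτ t ht => by
      rw [hχ1 t (by linarith), hχ1 (t - τ) (by linarith), sub_self]
  obtain ⟨B₀, hB₀⟩ := exists_cutoff_mul_bound a₀ a₁ a₂ (τ := 0) (T := 5 * τ₂) hτ₁ hτ₂.le le_rfl
    (by linarith) (by linarith) (by linarith) hχ' hχ'0 hχ'1
  obtain ⟨B₁, hB₁⟩ := exists_cutoff_mul_bound a₀ a₁ a₂ (τ := τ₁) (T := 5 * τ₂) hτ₁ hτ₂.le hτ₁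
    (by linarith) (by linarith) (by linarith) (hκs τ₁) (hκ0 τ₁ hτ₁) (hκ1 τ₁ hτ₁ hτ)
  obtain ⟨B₂, hB₂⟩ := exists_cutoff_mul_bound a₀ a₁ a₂ (τ := τ₂) (T := 5 * τ₂) hτ₁ hτ₂.le hτ₂.le
    (by linarith) (by linarith) (by linarith) (hκs τ₂) (hκ0 τ₂ hτ₂.le) (hκ1 τ₂ hτ₂.le le_rfl)
  obtain ⟨K, hK, hbound⟩ := exists_forced_solution_bound (T := 5 * τ₂) hτ₁ hτ₂.le (by linarith) hne
  set M := 2 * (|a₀| + |a₁| + |a₂|) + 1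
  -- The second entry serves `t ≤ 3 τ₂`, where `χ y` need not equal `y`: the a priori bound applies,
  -- and `exp (|σ| * (3 * τ₂))` compensates for a small `exp (σ t)`.
  refine ⟨max (K * (B₀ + |a₁| * B₁ + |a₂| * B₂))
    (2 * Real.exp (M * (3 * τ₂)) * Real.exp (|σ| * (3 * τ₂))), fun N y hy t ht => ?_⟩
  have hN := hy.nonneg
  rcases le_total t (3 * τ₂) with ht3 | ht3
  · have h1 := hy.abs_le_of_le hτ₁ hτ₂.le (by linarith) ht3
    have h2 : 1 ≤ Real.exp (|σ| * (3 * τ₂)) * Real.exp (σ * t) := by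
      rw [← Real.exp_add]
      refine Real.one_le_exp ?_
      have h3 : |σ| * t ≤ |σ| * (3 * τ₂) := by gcongr
      have h4 : -|σ| * t ≤ σ * t := mul_le_mul_of_nonneg_right (neg_abs_le σ) ht
      linarith
    calc |y t| ≤ 2 * N * Real.exp (M * (3 * τ₂)) * 1 := by rw [mul_one]; exact h1
      _ ≤ 2 * N * Real.exp (M * (3 * τ₂)) * (Real.exp (|σ| * (3 * τ₂)) * Real.exp (σ * t)) := by
        gcongr
      _ = (2 * Real.exp (M * (3 * τ₂)) * Real.exp (|σ| * (3 * τ₂))) * Real.exp (σ * t) * N := by ring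
      _ ≤ _ := by gcongr; exact le_max_right _ _
  · obtain ⟨f₀, hd₀, hc₀, hz₀, hz₀', hb₀⟩ := hB₀ N y hy
    obtain ⟨f₁, hd₁, hc₁, hz₁, hz₁', hb₁⟩ := hB₁ N y hy
    obtain ⟨f₂, hd₂, hc₂, hz₂, hz₂', hb₂⟩ := hB₂ N y hy
    set r : ℝ → ℝ := fun t => deriv χ t * y (t - 0) + a₁ * ((χ (t - τ₁) - χ t) * y (t - τ₁))
      + a₂ * ((χ (t - τ₂) - χ t) * y (t - τ₂)) with hr
    set r' : ℝ → ℝ := fun t => f₀ t + a₁ * f₁ t + a₂ * f₂ t with hr'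
    have hrd : ∀ t, HasDerivAt r (r' t) t := fun t =>
      ((hd₀ t).add ((hd₁ t).const_mul a₁)).add ((hd₂ t).const_mul a₂)
    have hxd : ∀ t, HasDerivAt (fun t => χ t * y t) (r t - a₀ * (χ t * y t)
        - a₁ * (χ (t - τ₁) * y (t - τ₁)) - a₂ * (χ (t - τ₂) * y (t - τ₂))) t := fun t => by
      have := hy.hasDerivAt_cutoff_mul hχ1s hχ0 (by linarith : (0 : ℝ) < 2 * τ₂) t
      simp only [sub_zero] at this
      refine this.congr_deriv ?_
      simp only [hr, sub_zero]
      ring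
    have key := hbound (fun t => ((χ t * y t : ℝ) : ℂ)) (fun t => (r t : ℂ)) (fun t => (r' t : ℂ))
      ((B₀ + |a₁| * B₁ + |a₂| * B₂) * N) (2 * N) M (fun t ht => by
        rw [hχ0 t (by linarith), zero_mul, Complex.ofReal_zero]) (fun t => by
        rw [Complex.norm_real, Real.norm_eq_abs]
        rcases le_total t 0 with h | h
        · rw [hχ0 t (by linarith), zero_mul, abs_zero]; positivity
        · rw [abs_mul, abs_of_nonneg (Real.smoothTransition.nonneg _)]
          exact (mul_le_of_le_one_left (abs_nonneg _) (Real.smoothTransition.le_one _)).trans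
            (hy.abs_le_exp hτ₁ hτ₂.le h)) (fun t => by
        have := (hxd t).ofReal_comp
        push_cast at this ⊢
        exact this)
      (fun t => (hrd t).ofReal_comp) (by fun_prop) (fun t ht => by
        simp only [hr, hz₀ t ht, hz₁ t ht, hz₂ t ht, mul_zero, add_zero, Complex.ofReal_zero])
      (fun t ht => by
        simp only [hr', hz₀' t ht, hz₁' t ht, hz₂' t ht, mul_zero, add_zero, Complex.ofReal_zero])
      (fun t => by
        rw [Complex.norm_real, Real.norm_eq_abs]
        refine (abs_add_three _ _ _).trans ?_
        rw [abs_mul, abs_mul, add_mul, add_mul, mul_assoc, mul_assoc]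
        gcongr
        · exact hb₀ t
        · exact hb₁ t
        · exact hb₂ t) t
    rw [Complex.norm_real, Real.norm_eq_abs, hχ1 t ht3, one_mul] at key
    calc |y t| ≤ _ := key
      _ = K * (B₀ + |a₁| * B₁ + |a₂| * B₂) * Real.exp (σ * t) * N := by ring
      _ ≤ _ := by gcongr; exact le_max_left _ _

theorem isExponentiallyStable_of_isStrictlyDominantRoot {a₀ a₁ a₂ τ₁ τ₂ s₀ : ℝ} (hτ₁ : 0 ≤ τ₁)
    (hτ₂ : 0 < τ₂) (hτ : τ₁ ≤ τ₂) (hs₀ : s₀ < 0)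
    (hdom : IsStrictlyDominantRoot (charFunction a₀ a₁ a₂ τ₁ τ₂) s₀) :
    IsExponentiallyStable a₀ a₁ a₂ τ₁ τ₂ := by
  -- As `s₀ < s₀ / 2 < 0`, strict dominance excludes every root with `Re s ≥ s₀ / 2`.
  obtain ⟨K, hK⟩ := exists_solution_bound (σ := s₀ / 2) hτ₁ hτ₂ hτ fun s hs h => by
    rcases hdom.2 s h with rfl | h
    · rw [Complex.ofReal_re] at hs; linarith
    · linarith
  refine ⟨max K 1, -s₀ / 2, by positivity, by linarith, fun φ y hy t ht => ?_⟩
  have h := hK ‖φ‖ _ (hy.isBoundedHistorySolution hτ₂.le hτ) t ht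
  rw [max_eq_left (by linarith)] at h
  rw [show -(-s₀ / 2) * t = s₀ / 2 * t by ring]
  exact h.trans (by gcongr; exact le_max_left _ _)

theorem mainTheorem2 (a₀ a₁ a₂ τ₁ τ₂ s₀ : ℝ) (hτ₁ : 0 < τ₁) (hτ : τ₁ < τ₂)
    (hratio : τ₁ / τ₂ ∈ Set.Ioc (0 : ℝ) (2 / 3))
    (hmult : analyticOrderAt (charFunction a₀ a₁ a₂ τ₁ τ₂) (s₀ : ℂ) = 3) :
    IsStrictlyDominantRoot (charFunction a₀ a₁ a₂ τ₁ τ₂) s₀ ∧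
      (s₀ < 0 → IsExponentiallyStable a₀ a₁ a₂ τ₁ τ₂) := by
  have hdom := isStrictlyDominantRoot_of_order_three hτ₁ hτ hmult
  exact ⟨hdom, fun hs₀ => isExponentiallyStable_of_isStrictlyDominantRoot hτ₁.le (hτ₁.trans hτ)
    hτ.le hs₀ hdom⟩
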